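/- Let $p\in\{1,2,\dots\}$, $m\in\{0,1,2,\dots\}$, $0\le\mu\le\lambda$ and $0\le\alpha<1$. Let $\mathbb U=\{z\in\mathbb C:|z|<1\}$ and $\mathbb U^*=\mathbb U\setminus\{0\}$. Let $\Sigma_p$ be the class of functions $f$ that are analytic and $p$-valent in $\mathbb U^*$ (no value is taken more than $p$ times, and some value is taken exactly $p$ times) and have the form $f(z)=z^{-p}+\sum_{k=1-p}^{\infty}a_kz^k$ there. For functions of this form the Hadamard product is $$\Bigl(z^{-p}+\sum_{k\ge 1-p}a_kz^k\Bigr)*\Bigl(z^{-p}+\sum_{k\ge 1-p}b_kz^k\Bigr)=z^{-p}+\sum_{k\ge 1-p}a_kb_kz^k .$$ Put $$D_{\lambda\mu p}f(z)=\lambda\mu\frac{[z^{p+1}f(z)]''}{z^{p-1}}+(\lambda-\mu)\frac{[z^{p+1}f(z)]'}{z^{p}}+(1-\lambda+\mu)f(z),$$ let $D^m=D^m_{\lambda\mu p}$ be its $m$-th iterate, and put $\Phi_k=[1+(k+p)(\lambda-\mu+(k+p+1)\lambda\mu)]^m$. Let $\Sigma_{\lambda\mu mp}(\alpha,1)$ be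 the class of all $f\in\Sigma_p$ such that $D^mf$ has no zero in $\mathbb U^*$ and $$\left|\frac1p\frac{z(D^mf(z))'}{D^mf(z)}+1\right|<\left|\frac1p\frac{z(D^mf(z))'}{D^mf(z)}+2\alpha-1\right|\qquad(z\in\mathbb U^*).\tag{1}$$ Theorem 2.2. A function $f\in\Sigma_p$ belongs to $\Sigma_{\lambda\mu mp}(\alpha,1)$ if and only if there is a Borel probability measure $\nu$ on $\partial\mathbb U$ such that, in $\mathbb U^*$, $$f(z)=\Bigl[z^{-p}+\sum_{k=1-p}^{\infty}\frac{z^k}{\Phi_k}\Bigr]*\Bigl[z^{-p}\exp\int_{|x|=1}2p(1-\alpha)\log(1-xz)\,d\nu(x)\Bigr],\tag{2}$$ where $\log$ is the principal logarithm. The correspondence given by (2) is one-to-one. That is, each $f\in\Sigma_{\lambda\mu mp}(\alpha,1)$ satisfies (2) for exactly one $\nu$, and each $\nu$ determines $f$ uniquely on $\mathbb U^*$. Moreover, for every probability measure $\nu$ on $\partial\mathbb U$ the right-hand side of (2) defines an analytic function of the form $z^{-p}+\sum_{k\ge1-p}a_kz^k$ on $\mathbb U^*$ that satisfies (1) and whose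 $m$-th iterate $D^mf$ has no zero in $\mathbb U^*$ (so it belongs to $\Sigma_{\lambda\mu mp}(\alpha,1)$ as soon as it is $p$-valent). The uniqueness of $\nu$, and its existence, also hold for every analytic function of this form that satisfies (1) with $D^mf$ zero-free in $\mathbb U^*$, whether or not it is $p$-valent. -/

import Mathlib

open MeasureTheory

noncomputable section

/-- The punctured open unit disk of the complex plane. -/
def puncturedDisk : Set ℂ := {z : ℂ | z ≠ 0 ∧ ‖z‖ < 1}

/-- `f z = z ^ (-p) + ∑_{k ≥ 1 - p} a_k z ^ k` on the punctured disk, where the coefficient `a_k`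
is stored as `a n` with `k = n + 1 - p`, `n = 0, 1, 2, …`. -/
def HasExpansion (p : ℕ) (f : ℂ → ℂ) (a : ℕ → ℂ) : Prop :=
  ∀ z ∈ puncturedDisk,
    HasSum (fun n : ℕ => a n * z ^ ((n : ℤ) + 1 - (p : ℤ))) (f z - z ^ (-(p : ℤ)))

/-- Functions analytic in the punctured disk, of the form `z ^ (-p) + ∑_{k ≥ 1 - p} a_k z ^ k`. -/
def IsMeroForm (p : ℕ) (f : ℂ → ℂ) : Prop :=
  AnalyticOnNhd ℂ f puncturedDisk ∧ ∃ a : ℕ → ℂ, HasExpansion p f a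

/-- `f` is `p`-valent in the punctured disk: no value is taken more than `p` times and some value
is taken exactly `p` times. -/
def IsPValent (p : ℕ) (f : ℂ → ℂ) : Prop :=
  (∀ w : ℂ, {z ∈ puncturedDisk | f z = w}.encard ≤ p) ∧
    ∃ w : ℂ, {z ∈ puncturedDisk | f z = w}.encard = p

/-- The class `Σ_p`. -/
def IsSigma (p : ℕ) (f : ℂ → ℂ) : Prop :=
  IsMeroForm p f ∧ IsPValent p f

/-- `h` is the Hadamard product (convolution) `f * g` on the punctured disk: the coefficients of
`h` are the products of those of `f` and `g`. -/
def IsHadamardProduct (p : ℕ) (f g h : ℂ → ℂ) : Prop :=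
  ∃ a b : ℕ → ℂ, HasExpansion p f a ∧ HasExpansion p g b ∧ HasExpansion p h (fun n => a n * b n)

/-- The differential operator `D_{λ μ p}`. -/
def diffOp (lam mu : ℝ) (p : ℕ) (f : ℂ → ℂ) : ℂ → ℂ := fun z =>
  (lam : ℂ) * mu * (deriv (deriv fun ζ : ℂ => ζ ^ (p + 1) * f ζ) z / z ^ ((p : ℤ) - 1))
    + ((lam : ℂ) - mu) * (deriv (fun ζ : ℂ => ζ ^ (p + 1) * f ζ) z / z ^ p)
    + (1 - (lam : ℂ) + mu) * f z

/-- The iterate `D^m_{λ μ p}`. -/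
def diffOpIter (lam mu : ℝ) (m p : ℕ) (f : ℂ → ℂ) : ℂ → ℂ :=
  (diffOp lam mu p)^[m] f

/-- The inequality
`|(1/p) z (D^m f)' / D^m f + 1| < β |(1/p) z (D^m f)' / D^m f + 2 α - 1|` on the punctured disk,
including that the quotient is defined there. -/
def ClassInequality (lam mu : ℝ) (m p : ℕ) (α β : ℝ) (f : ℂ → ℂ) : Prop :=
  ∀ z ∈ puncturedDisk,
    diffOpIter lam mu m p f z ≠ 0 ∧
    ‖1 / (p : ℂ) * (z * deriv (diffOpIter lam mu m p f) z / diffOpIter lam mu m p f z) + 1‖ <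
      β * ‖1 / (p : ℂ) * (z * deriv (diffOpIter lam mu m p f) z / diffOpIter lam mu m p f z)
        + 2 * (α : ℂ) - 1‖

/-- The class `Σ_{λ μ m p}(α, β)`. -/
def IsSigmaClass (lam mu : ℝ) (m p : ℕ) (α β : ℝ) (f : ℂ → ℂ) : Prop :=
  IsSigma p f ∧ ClassInequality lam mu m p α β f

/-- `Φ_k(λ, μ, m, p) = [1 + (k + p) (λ - μ + (k + p + 1) λ μ)] ^ m`. -/
def Phi (lam mu : ℝ) (m p : ℕ) (k : ℤ) : ℝ :=
  (1 + ((k : ℝ) + p) * (lam - mu + ((k : ℝ) + p + 1) * (lam * mu))) ^ m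

/-- `z ^ (-p) + ∑_{k ≥ 1 - p} z ^ k / Φ_k`, summed over `k = n + 1 - p`, `n = 0, 1, 2, …`. -/
def phiKernel (lam mu : ℝ) (m p : ℕ) (z : ℂ) : ℂ :=
  z ^ (-(p : ℤ)) + ∑' n : ℕ,
    z ^ ((n : ℤ) + 1 - (p : ℤ)) / (Phi lam mu m p ((n : ℤ) + 1 - (p : ℤ)) : ℂ)

/-- `z ^ (-p) exp ∫_{|x| = 1} 2 p (1 - α) log (1 - x z) dν(x)`, with the principal logarithm. -/
def expKernel (p : ℕ) (α : ℝ) (ν : ProbabilityMeasure (Metric.sphere (0 : ℂ) 1)) (z : ℂ) : ℂ :=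
  z ^ (-(p : ℤ)) * Complex.exp
    (∫ x : Metric.sphere (0 : ℂ) 1, 2 * (p : ℂ) * (1 - (α : ℂ)) * Complex.log (1 - (x : ℂ) * z)
      ∂(ν : Measure (Metric.sphere (0 : ℂ) 1)))

/-- `f` is the Hadamard product of `phiKernel` with the `expKernel` of `ν`. -/
def IsRepresentedBy (lam mu : ℝ) (m p : ℕ) (α : ℝ) (f : ℂ → ℂ)
    (ν : ProbabilityMeasure (Metric.sphere (0 : ℂ) 1)) : Prop :=
  IsHadamardProduct p (phiKernel lam mu m p) (expKernel p α ν) f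

end

/-!
Write `f = z ^ (-p) * F` with `F` holomorphic on the unit disk and `F 0 = 1`. In terms of the Euler
operator `θ = z d/dz` the differential operator acts on `F` as the polynomial
`1 + (lam - mu) θ + lam mu (θ ^ 2 + θ)`, so it multiplies the coefficient of `z ^ n` by a number that
is at least `1`, and its `m`-th iterate multiplies the coefficient `a_k` of `f` by `Φ_k`. Hence it is
inverse to the Hadamard product with `phiKernel`, and `f` is represented by `ν` if and only if
`D^m f = expKernel p α ν` on the punctured disk (`isRepresentedBy_iff`); moreover every function with
an expansion is of the form `D^m f` (`exists_diffOpIter_eqOn`).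

It remains to compare the inequality of the class with the exponential kernels for the function
`D^m f = z ^ (-p) * G`. The inequality says that `G` is zero-free and `Re (z G' / G) < p (1 - α)`
(`class_inequality_iff`), that is, `P = 1 - z G' / (p (1 - α) G)` has positive real part. Since
`P 0 = 1`, Herglotz's theorem (`exists_herglotz_representation`) gives a probability measure `ν` on
the circle with `P z = ∫ (1 + x z) / (1 - x z) dν(x)`. As `θ log (1 - x z) = 1 - 1 / (1 - x z)`, this
says that `G` and `exp (2 p (1 - α) ∫ log (1 - x z) dν(x))` have the same logarithmic derivative, so
they agree (`exists_eq_exp_logPotential`). Conversely, `Re (1 / (1 - x z)) > 1 / 2` on the disk gives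
the inequality for every exponential kernel.

Herglotz's theorem is obtained from the Poisson formula for `z ↦ Re (P (r z))`, the weak compactness
of the probability measures on the circle as `r → 1`, and the fact that a holomorphic function with
constant real part is constant. The measure is unique because the exponential kernel determines the
Cauchy transform `∫ 1 / (1 - x z) dν(x)`, whose Taylor coefficients are the moments of `ν`, and the
moments determine `ν` by the Stone–Weierstrass theorem (`measure_unitCircle_ext`).
-/

/-! ### Power series on the unit disk -/

/-- `G` is the sum of the power series with coefficients `c` on the open unit disk. -/
def IsDiskSeries (c : ℕ → ℂ) (G : ℂ → ℂ) : Prop :=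
  ∀ z ∈ Metric.ball (0 : ℂ) 1, HasSum (fun n => c n * z ^ n) (G z)

theorem eball_zero_one : Metric.eball (0 : ℂ) 1 = Metric.ball 0 1 := by
  rw [← ENNReal.ofReal_one, Metric.eball_ofReal]

theorem IsDiskSeries.hasFPowerSeriesOnBall {c : ℕ → ℂ} {G : ℂ → ℂ} (h : IsDiskSeries c G) :
    HasFPowerSeriesOnBall G (FormalMultilinearSeries.ofScalars ℂ c) 0 1 where
  r_le := by
    refine ENNReal.le_of_forall_nnreal_lt fun r hr => ?_
    have hr1 : (r : ℝ) < 1 := by exact_mod_cast hr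
    have hs := (h (r : ℂ) (by simpa using hr1)).summable.norm
    refine FormalMultilinearSeries.le_radius_of_summable_norm _ ?_
    simpa [FormalMultilinearSeries.ofScalars_norm] using hs
  r_pos := one_pos
  hasSum := by
    intro y hy
    have hy' : y ∈ Metric.ball (0 : ℂ) 1 := eball_zero_one ▸ hy
    simpa [FormalMultilinearSeries.ofScalars_apply_eq, mul_comm] using h y hy'

theorem IsDiskSeries.differentiableOn {c : ℕ → ℂ} {G : ℂ → ℂ} (h : IsDiskSeries c G) :
    DifferentiableOn ℂ G (Metric.ball 0 1) := by
  have := h.hasFPowerSeriesOnBall.differentiableOn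
  rwa [eball_zero_one] at this

/-- Agreement off the centre suffices, as both sums are continuous there. -/
theorem IsDiskSeries.unique {c d : ℕ → ℂ} {G H : ℂ → ℂ} (hc : IsDiskSeries c G)
    (hd : IsDiskSeries d H) (hGH : ∀ᶠ z in nhdsWithin 0 {0}ᶜ, G z = H z) : c = d := by
  have hGH' : ∀ᶠ z in nhds (0 : ℂ), G z = H z := by
    have hb : Metric.ball (0 : ℂ) 1 ∈ nhds 0 := Metric.ball_mem_nhds _ one_pos
    have hG := (hc.differentiableOn.differentiableAt hb).continuousAt
    have hH := (hd.differentiableOn.differentiableAt hb).continuousAt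
    exact (ContinuousAt.eventuallyEq_nhds_iff_eventuallyEq_nhdsNE hG hH).1 hGH
  exact FormalMultilinearSeries.ofScalars_series_injective ℂ ℂ
    (hc.hasFPowerSeriesOnBall.hasFPowerSeriesAt.eq_formalMultilinearSeries_of_eventually
      hd.hasFPowerSeriesOnBall.hasFPowerSeriesAt hGH')

theorem isDiskSeries_taylor {G : ℂ → ℂ} (hG : DifferentiableOn ℂ G (Metric.ball 0 1)) :
    IsDiskSeries (fun n => (n.factorial : ℂ)⁻¹ * iteratedDeriv n G 0) G := by
  intro z hz
  convert! Complex.hasSum_taylorSeries_on_ball hG hz using 2 with n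
  simp only [sub_zero, smul_eq_mul]
  ring

theorem IsDiskSeries.exists_of_differentiableOn {G : ℂ → ℂ}
    (hG : DifferentiableOn ℂ G (Metric.ball 0 1)) : ∃ c, IsDiskSeries c G :=
  ⟨_, isDiskSeries_taylor hG⟩

theorem IsDiskSeries.apply_zero {c : ℕ → ℂ} {G : ℂ → ℂ} (h : IsDiskSeries c G) :
    c 0 = G 0 := by
  have h0 := h 0 (by simp)
  have h1 : HasSum (fun n => c n * (0 : ℂ) ^ n) (c 0) := by
    simpa using hasSum_single (f := fun n => c n * (0 : ℂ) ^ n) 0 (fun n hn => by simp [hn])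
  exact h1.unique h0

/-- The Euler operator `z d/dz` multiplies the `n`-th coefficient by `n`. -/
theorem IsDiskSeries.euler {c : ℕ → ℂ} {G : ℂ → ℂ} (h : IsDiskSeries c G) :
    IsDiskSeries (fun n => n * c n) (fun z => z * deriv G z) := by
  have hG := h.differentiableOn
  have hc : c = fun n => (n.factorial : ℂ)⁻¹ * iteratedDeriv n G 0 :=
    h.unique (isDiskSeries_taylor hG) (Filter.Eventually.of_forall fun _ => rfl)
  intro z hz
  have h1 := (isDiskSeries_taylor (hG.deriv Metric.isOpen_ball) z hz).mul_left z
  rw [← hasSum_nat_add_iff' 1]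
  simp only [Finset.range_one, Finset.sum_singleton, Nat.cast_zero, zero_mul, sub_zero]
  convert! h1 using 2 with n
  simp only [hc, iteratedDeriv_succ', Nat.factorial_succ]
  push_cast
  have : ((n : ℂ) + 1) ≠ 0 := by exact_mod_cast n.succ_ne_zero
  have : (n.factorial : ℂ) ≠ 0 := by exact_mod_cast n.factorial_ne_zero
  field_simp
  ring

/-- A holomorphic function on the disk whose derivative vanishes off the origin is constant. -/
theorem eqOn_const_of_euler_eq_zero {Q : ℂ → ℂ} (hQ : DifferentiableOn ℂ Q (Metric.ball 0 1))
    (h : ∀ z ∈ Metric.ball (0 : ℂ) 1, z * deriv Q z = 0) :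
    ∀ z ∈ Metric.ball (0 : ℂ) 1, Q z = Q 0 := by
  obtain ⟨q, hq⟩ := IsDiskSeries.exists_of_differentiableOn hQ
  have h0 : IsDiskSeries (fun _ => 0) (fun _ => 0) := fun z _ => by simp
  have hq0 : (fun n : ℕ => (n : ℂ) * q n) = fun _ => 0 := by
    refine hq.euler.unique h0 ?_
    filter_upwards [nhdsWithin_le_nhds (Metric.ball_mem_nhds (0 : ℂ) one_pos)] with z hz
    exact h z hz
  intro z hz
  have h1 : HasSum (fun n => q n * z ^ n) (q 0) := by
    have hn : ∀ n, n ≠ 0 → q n * z ^ n = 0 := fun n hn => by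
      have := congrFun hq0 n
      simp only [mul_eq_zero, Nat.cast_eq_zero, hn, false_or] at this
      simp [this]
    simpa using hasSum_single (f := fun n => q n * z ^ n) 0 hn
  rw [(hq z hz).unique h1, hq.apply_zero]

/-! ### Expansions on the punctured disk -/

theorem isOpen_puncturedDisk : IsOpen puncturedDisk := by
  have : puncturedDisk = {0}ᶜ ∩ Metric.ball (0 : ℂ) 1 := by
    ext z; simp [puncturedDisk]
  rw [this]
  exact isOpen_compl_singleton.inter Metric.isOpen_ball

theorem puncturedDisk_subset_ball : puncturedDisk ⊆ Metric.ball (0 : ℂ) 1 :=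
  fun z hz => by simpa using hz.2

theorem puncturedDisk_mem_nhdsNE : puncturedDisk ∈ nhdsWithin (0 : ℂ) {0}ᶜ := by
  filter_upwards [nhdsWithin_le_nhds (Metric.ball_mem_nhds (0 : ℂ) one_pos),
    self_mem_nhdsWithin] with z hz hz0
  exact ⟨hz0, by simpa using hz⟩

/-- The sequence `1, a 0, a 1, …`: the power series coefficients of `z ^ p * f z` when `f` has
expansion coefficients `a`. -/
def consOne (a : ℕ → ℂ) : ℕ → ℂ
  | 0 => 1
  | n + 1 => a n

theorem zpow_shift {z : ℂ} (hz : z ≠ 0) (p n : ℕ) :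
    z ^ ((n : ℤ) + 1 - (p : ℤ)) = z ^ (-(p : ℤ)) * z ^ (n + 1) := by
  rw [← zpow_natCast z (n + 1), ← zpow_add₀ hz]
  congr 1
  push_cast
  ring

theorem hasExpansion_iff {p : ℕ} {f : ℂ → ℂ} {a : ℕ → ℂ} :
    HasExpansion p f a ↔
      ∃ G, IsDiskSeries (consOne a) G ∧ ∀ z ∈ puncturedDisk, f z = z ^ (-(p : ℤ)) * G z := by
  constructor
  · intro h
    have key : ∀ z ∈ puncturedDisk,
        HasSum (fun n => consOne a n * z ^ n) (z ^ p * f z) := by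
      intro z hz
      rw [← hasSum_nat_add_iff' 1]
      have h1 := (h z hz).mul_left (z ^ p)
      have hzp : z ^ p * z ^ (-(p : ℤ)) = 1 := by
        rw [zpow_neg, zpow_natCast]
        exact mul_inv_cancel₀ (pow_ne_zero _ hz.1)
      convert! h1 using 1
      · funext n
        rw [zpow_shift hz.1]
        simp only [consOne]
        linear_combination (-(a n * z ^ (n + 1))) * hzp
      · simp only [Finset.range_one, Finset.sum_singleton, consOne, pow_zero]
        linear_combination hzp
    classical
    refine ⟨fun z => if z = 0 then 1 else z ^ p * f z, ?_, ?_⟩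
    · intro z hz
      by_cases h0 : z = 0
      · subst h0
        simpa [consOne] using
          hasSum_single (f := fun n => consOne a n * (0 : ℂ) ^ n) 0 (fun n hn => by simp [hn])
      · simpa [h0] using key z ⟨h0, by simpa using hz⟩
    · intro z hz
      simp only [hz.1, if_false]
      rw [← mul_assoc, zpow_neg, zpow_natCast, inv_mul_cancel₀ (pow_ne_zero _ hz.1), one_mul]
  · rintro ⟨G, hG, hf⟩ z hz
    have h1 := hG z (puncturedDisk_subset_ball hz)
    rw [← hasSum_nat_add_iff' 1] at h1
    have h2 := h1.mul_left (z ^ (-(p : ℤ)))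
    convert! h2 using 1
    · funext n
      rw [zpow_shift hz.1]
      simp only [consOne]
      ring
    · rw [hf z hz]
      simp only [Finset.range_one, Finset.sum_singleton, consOne, pow_zero]
      ring

theorem HasExpansion.unique {p : ℕ} {f : ℂ → ℂ} {a b : ℕ → ℂ} (ha : HasExpansion p f a)
    (hb : HasExpansion p f b) : a = b := by
  obtain ⟨G, hG, hfG⟩ := hasExpansion_iff.1 ha
  obtain ⟨H, hH, hfH⟩ := hasExpansion_iff.1 hb
  have : consOne a = consOne b := by
    refine hG.unique hH ?_
    filter_upwards [puncturedDisk_mem_nhdsNE] with z hz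
    exact mul_left_cancel₀ (zpow_ne_zero _ hz.1) ((hfG z hz).symm.trans (hfH z hz))
  funext n
  exact congrFun this (n + 1)

theorem HasExpansion.eqOn {p : ℕ} {f g : ℂ → ℂ} {a : ℕ → ℂ} (hf : HasExpansion p f a)
    (hg : HasExpansion p g a) : Set.EqOn f g puncturedDisk := fun z hz => by
  simpa using (hf z hz).unique (hg z hz)

theorem HasExpansion.congr {p : ℕ} {f g : ℂ → ℂ} {a : ℕ → ℂ} (hf : HasExpansion p f a)
    (hfg : Set.EqOn f g puncturedDisk) : HasExpansion p g a := fun z hz => by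
  simpa [hfg hz] using hf z hz

theorem HasExpansion.analyticOnNhd {p : ℕ} {f : ℂ → ℂ} {a : ℕ → ℂ} (hf : HasExpansion p f a) :
    AnalyticOnNhd ℂ f puncturedDisk := by
  obtain ⟨G, hG, hfG⟩ := hasExpansion_iff.1 hf
  refine DifferentiableOn.analyticOnNhd ?_ isOpen_puncturedDisk
  refine DifferentiableOn.congr (fun z hz => ?_) hfG
  exact ((differentiableAt_zpow.2 (Or.inl hz.1)).differentiableWithinAt).mul
    ((hG.differentiableOn.mono puncturedDisk_subset_ball) z hz)

/-! ### The differential operator and the Hadamard product -/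

/-- The factor by which one application of the differential operator multiplies the coefficient of
`z ^ (n - p)`. -/
def diffOpFactor (lam mu : ℝ) (n : ℕ) : ℝ :=
  1 + (n : ℝ) * (lam - mu + ((n : ℝ) + 1) * (lam * mu))

theorem one_le_diffOpFactor {lam mu : ℝ} (hmu : 0 ≤ mu) (hlam : mu ≤ lam) (n : ℕ) :
    1 ≤ diffOpFactor lam mu n := by
  have h1 : 0 ≤ lam - mu := sub_nonneg.2 hlam
  have h2 : 0 ≤ lam := hmu.trans hlam
  rw [diffOpFactor, le_add_iff_nonneg_right]
  positivity

theorem Phi_eq_diffOpFactor_pow (lam mu : ℝ) (m p n : ℕ) :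
    Phi lam mu m p ((n : ℤ) + 1 - (p : ℤ)) = diffOpFactor lam mu (n + 1) ^ m := by
  simp only [Phi, diffOpFactor]
  push_cast
  ring

theorem one_le_Phi {lam mu : ℝ} (hmu : 0 ≤ mu) (hlam : mu ≤ lam) (m p n : ℕ) :
    1 ≤ Phi lam mu m p ((n : ℤ) + 1 - (p : ℤ)) := by
  rw [Phi_eq_diffOpFactor_pow]
  exact one_le_pow₀ (one_le_diffOpFactor hmu hlam _)

/-- In terms of the Euler operator `θ = z d/dz`, the differential operator sends `z ^ (-p) * G` to
`z ^ (-p) * (1 + (lam - mu) * θ + lam * mu * (θ ^ 2 + θ)) G`. -/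
theorem diffOp_eq_euler (lam mu : ℝ) {p : ℕ} {f G : ℂ → ℂ}
    (hG : DifferentiableOn ℂ G (Metric.ball 0 1))
    (hf : ∀ z ∈ puncturedDisk, f z = z ^ (-(p : ℤ)) * G z) {z : ℂ} (hz : z ∈ puncturedDisk) :
    diffOp lam mu p f z = z ^ (-(p : ℤ)) *
      (G z + (lam - mu) * (z * deriv G z) +
        lam * mu * (z * deriv (fun w => w * deriv G w) z + z * deriv G z)) := by
  have hG' := hG.deriv Metric.isOpen_ball
  have hat : ∀ w ∈ puncturedDisk, DifferentiableAt ℂ G w := fun w hw =>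
    hG.differentiableAt (Metric.isOpen_ball.mem_nhds (puncturedDisk_subset_ball hw))
  have hat' : DifferentiableAt ℂ (deriv G) z :=
    hG'.differentiableAt (Metric.isOpen_ball.mem_nhds (puncturedDisk_subset_ball hz))
  have e1 : Set.EqOn (fun ζ : ℂ => ζ ^ (p + 1) * f ζ) (fun ζ => ζ * G ζ) puncturedDisk := by
    intro w hw
    have hwp : w ^ p * w ^ (-(p : ℤ)) = 1 := by
      rw [zpow_neg, zpow_natCast]
      exact mul_inv_cancel₀ (pow_ne_zero _ hw.1)
    simp only [hf w hw, pow_succ]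
    linear_combination (w * G w) * hwp
  have e2 : Set.EqOn (deriv fun ζ : ℂ => ζ ^ (p + 1) * f ζ) (fun ζ => G ζ + ζ * deriv G ζ)
      puncturedDisk := by
    intro w hw
    rw [(e1.eventuallyEq_of_mem (isOpen_puncturedDisk.mem_nhds hw)).deriv_eq]
    simpa using ((hasDerivAt_id' w).fun_mul (hat w hw).hasDerivAt).deriv
  have e3 : deriv (deriv fun ζ : ℂ => ζ ^ (p + 1) * f ζ) z =
      deriv G z + deriv (fun w => w * deriv G w) z := by
    rw [(e2.eventuallyEq_of_mem (isOpen_puncturedDisk.mem_nhds hz)).deriv_eq]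
    exact deriv_fun_add (hat z hz) (differentiableAt_id.mul hat')
  have hz0 := hz.1
  have hp1 : z ^ ((p : ℤ) - 1) = z ^ p / z := by rw [zpow_sub_one₀ hz0, zpow_natCast]; rfl
  simp only [diffOp]
  rw [e3, e2 hz, hf z hz, hp1, zpow_neg, zpow_natCast]
  have : z ^ p ≠ 0 := pow_ne_zero _ hz0
  field_simp
  ring

theorem HasExpansion.diffOp {lam mu : ℝ} {p : ℕ} {f : ℂ → ℂ} {a : ℕ → ℂ}
    (h : HasExpansion p f a) :
    HasExpansion p (diffOp lam mu p f) (fun n => diffOpFactor lam mu (n + 1) * a n) := by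
  obtain ⟨G, hG, hf⟩ := hasExpansion_iff.1 h
  refine hasExpansion_iff.2 ⟨_, fun z hz => ?_, fun z hz =>
    diffOp_eq_euler lam mu hG.differentiableOn hf hz⟩
  have h1 := hG.euler z hz
  have h2 := hG.euler.euler z hz
  have h3 := ((hG z hz).add (h1.mul_left ((lam : ℂ) - mu))).add
    ((h2.add h1).mul_left ((lam : ℂ) * mu))
  convert! h3 using 1
  funext n
  cases n with
  | zero => simp [consOne]
  | succ n =>
    simp only [consOne, diffOpFactor]
    push_cast
    ring

theorem HasExpansion.diffOpIter {lam mu : ℝ} {m p : ℕ} {f : ℂ → ℂ} {a : ℕ → ℂ}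
    (h : HasExpansion p f a) :
    HasExpansion p (diffOpIter lam mu m p f)
      (fun n => Phi lam mu m p ((n : ℤ) + 1 - (p : ℤ)) * a n) := by
  simp only [Phi_eq_diffOpFactor_pow]
  induction m with
  | zero => simpa [_root_.diffOpIter] using h
  | succ m ih =>
    have := ih.diffOp (lam := lam) (mu := mu)
    rw [_root_.diffOpIter, Function.iterate_succ_apply']
    convert! this using 2 with n
    push_cast
    ring

theorem hasExpansion_phiKernel {lam mu : ℝ} (hmu : 0 ≤ mu) (hlam : mu ≤ lam) (m p : ℕ) :
    HasExpansion p (phiKernel lam mu m p)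
      (fun n => (Phi lam mu m p ((n : ℤ) + 1 - (p : ℤ)) : ℂ)⁻¹) := by
  intro z hz
  simp only [phiKernel, add_sub_cancel_left, div_eq_inv_mul]
  refine Summable.hasSum (Summable.of_norm_bounded
    (g := fun n : ℕ => ‖z ^ (-(p : ℤ))‖ * (‖z‖ * ‖z‖ ^ n)) ?_ fun n => ?_)
  · exact ((summable_geometric_of_lt_one (norm_nonneg _) hz.2).mul_left _).mul_left _
  · have h1 := one_le_Phi hmu hlam m p n
    rw [zpow_shift hz.1, norm_mul, norm_inv, Complex.norm_real, Real.norm_of_nonneg (by linarith),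
      norm_mul, norm_pow, pow_succ' ‖z‖]
    exact mul_le_of_le_one_left (by positivity) (inv_le_one_of_one_le₀ h1)

/-- A function with an expansion is represented by `ν` if and only if the kernel
`expKernel p α ν` is its image under the iterated differential operator, because that operator
undoes the Hadamard product with `phiKernel`. -/
theorem isRepresentedBy_iff {lam mu α : ℝ} (hmu : 0 ≤ mu) (hlam : mu ≤ lam) {m p : ℕ}
    {f : ℂ → ℂ} {ν : ProbabilityMeasure (Metric.sphere (0 : ℂ) 1)} :
    IsRepresentedBy lam mu m p α f ν ↔ (∃ a, HasExpansion p f a) ∧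
      Set.EqOn (diffOpIter lam mu m p f) (expKernel p α ν) puncturedDisk := by
  have hPhi : ∀ n : ℕ, (Phi lam mu m p ((n : ℤ) + 1 - (p : ℤ)) : ℂ) ≠ 0 := fun n => by
    have := one_le_Phi hmu hlam m p n
    exact_mod_cast (by linarith : Phi lam mu m p ((n : ℤ) + 1 - (p : ℤ)) ≠ 0)
  constructor
  · rintro ⟨a, b, ha, hb, hf⟩
    obtain rfl := ha.unique (hasExpansion_phiKernel hmu hlam m p)
    refine ⟨⟨_, hf⟩, HasExpansion.eqOn (a := b) ?_ hb⟩
    convert! hf.diffOpIter (lam := lam) (mu := mu) (m := m) using 2 with n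
    rw [mul_inv_cancel_left₀ (hPhi n)]
  · rintro ⟨⟨e, he⟩, heq⟩
    refine ⟨_, _, hasExpansion_phiKernel hmu hlam m p, he.diffOpIter.congr heq, ?_⟩
    convert! he using 2 with n
    rw [inv_mul_cancel_left₀ (hPhi n)]

/-- Dividing the coefficients by `Phi` preserves convergence, so every function with an expansion
is the image of another one under the iterated differential operator. -/
theorem exists_diffOpIter_eqOn {lam mu : ℝ} (hmu : 0 ≤ mu) (hlam : mu ≤ lam) {m p : ℕ}
    {h : ℂ → ℂ} {b : ℕ → ℂ} (hb : HasExpansion p h b) :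
    ∃ f, IsMeroForm p f ∧ Set.EqOn (diffOpIter lam mu m p f) h puncturedDisk := by
  let a : ℕ → ℂ := fun n => (Phi lam mu m p ((n : ℤ) + 1 - (p : ℤ)) : ℂ)⁻¹ * b n
  let f : ℂ → ℂ := fun z => z ^ (-(p : ℤ)) + ∑' n : ℕ, a n * z ^ ((n : ℤ) + 1 - (p : ℤ))
  have hf : HasExpansion p f a := by
    intro z hz
    simp only [f, add_sub_cancel_left]
    refine Summable.hasSum (Summable.of_norm_bounded (hb z hz).summable.norm fun n => ?_)
    have h1 := one_le_Phi hmu hlam m p n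
    rw [norm_mul, norm_mul, norm_mul, norm_inv, Complex.norm_real,
      Real.norm_of_nonneg (by linarith), mul_assoc]
    exact mul_le_of_le_one_left (by positivity) (inv_le_one_of_one_le₀ h1)
  refine ⟨f, ⟨hf.analyticOnNhd, a, hf⟩, HasExpansion.eqOn (a := b) ?_ hb⟩
  convert! hf.diffOpIter (lam := lam) (mu := mu) (m := m) using 2 with n
  have h1 := one_le_Phi hmu hlam m p n
  rw [mul_inv_cancel_left₀]
  exact_mod_cast (by linarith : Phi lam mu m p ((n : ℤ) + 1 - (p : ℤ)) ≠ 0)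

/-! ### Cauchy transforms of measures on the circle -/

/-- The unit circle, on which the representing measures live. -/
abbrev UnitCircle : Type := Metric.sphere (0 : ℂ) 1

theorem UnitCircle.norm_coe (x : UnitCircle) : ‖(x : ℂ)‖ = 1 := by
  simp

theorem UnitCircle.norm_mul (x : UnitCircle) (z : ℂ) : ‖(x : ℂ) * z‖ = ‖z‖ := by
  rw [_root_.norm_mul, x.norm_coe, one_mul]

theorem UnitCircle.one_sub_mul_ne_zero (x : UnitCircle) {z : ℂ} (hz : ‖z‖ < 1) :
    1 - (x : ℂ) * z ≠ 0 := by
  intro h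
  have h1 := congrArg norm (sub_eq_zero.1 h)
  rw [x.norm_mul, norm_one] at h1
  linarith

theorem UnitCircle.one_sub_mul_mem_slitPlane (x : UnitCircle) {z : ℂ} (hz : ‖z‖ < 1) :
    1 - (x : ℂ) * z ∈ Complex.slitPlane := by
  simpa [sub_eq_add_neg] using Complex.mem_slitPlane_of_norm_lt_one (z := -((x : ℂ) * z))
    (by rwa [norm_neg, x.norm_mul])

theorem UnitCircle.norm_inv_one_sub_mul_le (x : UnitCircle) {z : ℂ} (hz : ‖z‖ < 1) :
    ‖(1 - (x : ℂ) * z)⁻¹‖ ≤ (1 - ‖z‖)⁻¹ := by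
  rw [norm_inv]
  refine inv_anti₀ (by linarith) ?_
  have := norm_sub_norm_le (1 : ℂ) (x * z)
  rwa [x.norm_mul, norm_one] at this

/-- The real part of the Cauchy kernel exceeds `1 / 2`, since `u ↦ 1 / (1 - u)` maps the unit disk
into a half-plane. -/
theorem UnitCircle.le_re_inv_one_sub_mul (x : UnitCircle) {z : ℂ} (hz : ‖z‖ < 1) :
    (1 + ‖z‖)⁻¹ ≤ ((1 - (x : ℂ) * z)⁻¹).re := by
  set u := (x : ℂ) * z with hu
  have hun : ‖u‖ = ‖z‖ := x.norm_mul z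
  have hne : 1 - u ≠ 0 := x.one_sub_mul_ne_zero hz
  have hpos : 0 < Complex.normSq (1 - u) := Complex.normSq_pos.2 hne
  have h1 : u.re ≤ ‖z‖ := hun ▸ Complex.re_le_norm u
  have h3 : -‖z‖ ≤ u.re := hun ▸ (abs_le.1 (Complex.abs_re_le_norm u)).1
  have h2 : Complex.normSq (1 - u) = 1 - 2 * u.re + ‖z‖ ^ 2 := by
    rw [← hun, ← Complex.normSq_eq_norm_sq, Complex.normSq_apply, Complex.normSq_apply]
    simp only [Complex.sub_re, Complex.sub_im, Complex.one_re, Complex.one_im]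
    ring
  rw [Complex.inv_re, inv_eq_one_div, div_le_div_iff₀ (by positivity) hpos, h2]
  simp only [Complex.sub_re, Complex.one_re]
  nlinarith [norm_nonneg z]

theorem continuous_inv_one_sub_mul {z : ℂ} (hz : ‖z‖ < 1) :
    Continuous fun x : UnitCircle => (1 - (x : ℂ) * z)⁻¹ :=
  Continuous.inv₀ (by fun_prop) fun x => x.one_sub_mul_ne_zero hz

theorem Continuous.integrable_unitCircle {E : Type*} [NormedAddCommGroup E]
    {g : UnitCircle → E} (hg : Continuous g)
    (ν : Measure UnitCircle) [IsFiniteMeasure ν] : Integrable g ν :=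
  hg.integrable_of_hasCompactSupport (HasCompactSupport.of_compactSpace g)

/-- The Cauchy transform `z ↦ ∫ 1 / (1 - x z) dν(x)` of a measure on the unit circle. -/
noncomputable def cauchyTransform (ν : Measure UnitCircle) (z : ℂ) : ℂ :=
  ∫ x : UnitCircle, (1 - (x : ℂ) * z)⁻¹ ∂ν

/-- The coefficients of the Cauchy transform are the moments of the measure. -/
theorem isDiskSeries_cauchyTransform (ν : Measure UnitCircle) [IsFiniteMeasure ν] :
    IsDiskSeries (fun n => ∫ x : UnitCircle, (x : ℂ) ^ n ∂ν) (cauchyTransform ν) := by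
  intro z hz
  have hz1 : ‖z‖ < 1 := by simpa using hz
  have h := hasSum_integral_of_dominated_convergence (μ := ν)
    (F := fun (n : ℕ) (x : UnitCircle) => ((x : ℂ) * z) ^ n)
    (f := fun x : UnitCircle => (1 - (x : ℂ) * z)⁻¹) (fun n _ => ‖z‖ ^ n)
    (fun n => (by fun_prop : Continuous _).aestronglyMeasurable)
    (fun n => Filter.Eventually.of_forall fun x => by rw [norm_pow, x.norm_mul])
    (Filter.Eventually.of_forall fun _ => summable_geometric_of_lt_one (norm_nonneg _) hz1)
    (integrable_const _)
    (Filter.Eventually.of_forall fun x => hasSum_geometric_of_norm_lt_one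
      (by rwa [x.norm_mul]))
  simp only [mul_pow, integral_mul_const] at h
  exact h

theorem cauchyTransform_zero (ν : Measure UnitCircle) [IsProbabilityMeasure ν] :
    cauchyTransform ν 0 = 1 := by
  simp [cauchyTransform]

theorem half_lt_re_cauchyTransform (ν : Measure UnitCircle) [IsProbabilityMeasure ν] {z : ℂ}
    (hz : ‖z‖ < 1) : 1 / 2 < (cauchyTransform ν z).re := by
  have hint := (continuous_inv_one_sub_mul hz).integrable_unitCircle ν
  have hre : (cauchyTransform ν z).re = ∫ x : UnitCircle, ((1 - (x : ℂ) * z)⁻¹).re ∂ν :=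
    (integral_re hint).symm
  have h1 : (1 + ‖z‖)⁻¹ ≤ ∫ x : UnitCircle, ((1 - (x : ℂ) * z)⁻¹).re ∂ν := by
    have := integral_mono (μ := ν) (integrable_const (1 + ‖z‖)⁻¹) hint.re
      fun x => x.le_re_inv_one_sub_mul hz
    simpa using this
  have h2 : (1 / 2 : ℝ) < (1 + ‖z‖)⁻¹ := by
    rw [one_div]
    exact inv_strictAnti₀ (by positivity) (by linarith)
  linarith

/-- A finite measure on the unit circle is determined by its moments of nonnegative order: those of
negative order are their conjugates, and the trigonometric polynomials are dense. -/
theorem measure_unitCircle_ext {ν₁ ν₂ : Measure UnitCircle} [IsFiniteMeasure ν₁]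
    [IsFiniteMeasure ν₂]
    (h : ∀ n : ℕ, ∫ x : UnitCircle, (x : ℂ) ^ n ∂ν₁ = ∫ x : UnitCircle, (x : ℂ) ^ n ∂ν₂) :
    ν₁ = ν₂ := by
  let e : BoundedContinuousFunction UnitCircle ℂ :=
    BoundedContinuousFunction.mkOfCompact ⟨fun x : UnitCircle => (x : ℂ), continuous_subtype_val⟩
  have hx0 : ∀ x : UnitCircle, (x : ℂ) ≠ 0 := fun x => norm_ne_zero_iff.1 (by simp [x.norm_coe])
  have hconj : ∀ x : UnitCircle, starRingEnd ℂ (x : ℂ) = (x : ℂ)⁻¹ := fun x => by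
    rw [Complex.inv_def, Complex.normSq_eq_norm_sq, x.norm_coe]; simp
  have hz : ∀ k : ℤ, ∫ x : UnitCircle, (x : ℂ) ^ k ∂ν₁ = ∫ x : UnitCircle, (x : ℂ) ^ k ∂ν₂ := by
    intro k
    obtain ⟨n, rfl | rfl⟩ := k.eq_nat_or_neg
    · simpa only [zpow_natCast] using h n
    · have hn : ∀ x : UnitCircle, (x : ℂ) ^ (-(n : ℤ)) = starRingEnd ℂ ((x : ℂ) ^ n) := fun x => by
        rw [map_pow, hconj, zpow_neg, zpow_natCast, inv_pow]
      simp only [hn, integral_conj, h n]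
  refine ext_of_forall_mem_subalgebra_integral_eq_of_polish (𝕜 := ℂ)
    (A := StarAlgebra.adjoin ℂ {e}) ?_ fun g hg => ?_
  · intro x y hxy
    exact ⟨e, ⟨_, ⟨e, StarAlgebra.self_mem_adjoin_singleton ℂ e, rfl⟩, rfl⟩,
      fun h => hxy (Subtype.ext h)⟩
  · have hg' : g ∈ Submodule.span ℂ
        (Submonoid.closure ({e} ∪ star {e}) : Set (BoundedContinuousFunction UnitCircle ℂ)) := by
      rw [← Algebra.adjoin_eq_span]
      exact hg
    clear hg
    induction hg' using Submodule.span_induction with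
    | mem g hg =>
      -- Every monomial in the coordinate and its conjugate is an integer power.
      obtain ⟨k, hk⟩ : ∃ k : ℤ, ∀ x : UnitCircle, g x = (x : ℂ) ^ k := by
        induction hg using Submonoid.closure_induction with
        | mem g hg =>
          rcases hg with rfl | hg
          · exact ⟨1, fun x => by simp [e]⟩
          · obtain rfl : g = star e := by rw [← star_star g, Set.mem_singleton_iff.1 hg]
            exact ⟨-1, fun x => by simpa [e] using hconj x⟩
        | one => exact ⟨0, fun x => by simp⟩
        | mul g₁ g₂ _ _ h₁ h₂ =>
          obtain ⟨k₁, h₁⟩ := h₁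
          obtain ⟨k₂, h₂⟩ := h₂
          exact ⟨k₁ + k₂, fun x => by simp [h₁, h₂, zpow_add₀ (hx0 x)]⟩
      simpa only [hk] using hz k
    | zero => simp
    | add g₁ g₂ _ _ h₁ h₂ =>
      simp only [BoundedContinuousFunction.coe_add, Pi.add_apply]
      rw [integral_add (g₁.integrable _) (g₂.integrable _),
        integral_add (g₁.integrable _) (g₂.integrable _), h₁, h₂]
    | smul c g _ h =>
      simp only [BoundedContinuousFunction.coe_smul]
      rw [integral_smul, integral_smul, h]

theorem eq_of_cauchyTransform_eqOn {ν₁ ν₂ : Measure UnitCircle} [IsFiniteMeasure ν₁]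
    [IsFiniteMeasure ν₂]
    (h : Set.EqOn (cauchyTransform ν₁) (cauchyTransform ν₂) puncturedDisk) : ν₁ = ν₂ :=
  measure_unitCircle_ext fun n => congrFun ((isDiskSeries_cauchyTransform ν₁).unique
    (isDiskSeries_cauchyTransform ν₂) (Filter.eventually_of_mem puncturedDisk_mem_nhdsNE h)) n

/-! ### Logarithmic potentials of measures on the circle -/

/-- The logarithmic potential `z ↦ ∫ log (1 - x z) dν(x)` of a measure on the unit circle. -/
noncomputable def logPotential (ν : Measure UnitCircle) (z : ℂ) : ℂ :=
  ∫ x : UnitCircle, Complex.log (1 - (x : ℂ) * z) ∂ν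

theorem logPotential_zero (ν : Measure UnitCircle) : logPotential ν 0 = 0 := by
  simp [logPotential]

theorem hasDerivAt_logPotential (ν : Measure UnitCircle) [IsFiniteMeasure ν] {z : ℂ}
    (hz : ‖z‖ < 1) :
    HasDerivAt (logPotential ν) (∫ x : UnitCircle, -(x : ℂ) / (1 - (x : ℂ) * z) ∂ν) z := by
  obtain ⟨r, hzr, hr1⟩ := exists_between hz
  have hcont : ∀ w : ℂ, ‖w‖ < 1 →
      Continuous fun x : UnitCircle => Complex.log (1 - (x : ℂ) * w) := fun w hw =>
    Continuous.clog (by fun_prop) fun x => x.one_sub_mul_mem_slitPlane hw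
  have hs : Metric.ball (0 : ℂ) r ∈ nhds z := Metric.isOpen_ball.mem_nhds (by simpa using hzr)
  have hlt : ∀ w ∈ Metric.ball (0 : ℂ) r, ‖w‖ < 1 := fun w hw =>
    (by simpa using hw : ‖w‖ < r).trans hr1
  refine (hasDerivAt_integral_of_dominated_loc_of_deriv_le (μ := ν) (s := Metric.ball (0 : ℂ) r)
    (F := fun (w : ℂ) (x : UnitCircle) => Complex.log (1 - (x : ℂ) * w))
    (F' := fun (w : ℂ) (x : UnitCircle) => -(x : ℂ) / (1 - (x : ℂ) * w))
    (bound := fun _ => (1 - r)⁻¹) hs ?_ ((hcont z hz).integrable_unitCircle ν) ?_ ?_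
    (integrable_const _) ?_).2
  · filter_upwards [hs] with w hw
    exact (hcont w (hlt w hw)).aestronglyMeasurable
  · exact (Continuous.mul (by fun_prop) (continuous_inv_one_sub_mul hz)).aestronglyMeasurable
  · refine Filter.Eventually.of_forall fun x w hw => ?_
    rw [div_eq_mul_inv, norm_mul, norm_neg, x.norm_coe, one_mul]
    refine (x.norm_inv_one_sub_mul_le (hlt w hw)).trans ?_
    have : ‖w‖ < r := by simpa using hw
    exact inv_anti₀ (by linarith) (by linarith)
  · refine Filter.Eventually.of_forall fun x w hw => ?_
    have h1 : HasDerivAt (fun w : ℂ => 1 - (x : ℂ) * w) (-(x : ℂ)) w := by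
      simpa using ((hasDerivAt_id' w).const_mul (x : ℂ)).const_sub 1
    exact h1.clog (x.one_sub_mul_mem_slitPlane (hlt w hw))

theorem differentiableOn_logPotential (ν : Measure UnitCircle) [IsFiniteMeasure ν] :
    DifferentiableOn ℂ (logPotential ν) (Metric.ball 0 1) := fun z hz =>
  (hasDerivAt_logPotential ν (by simpa using hz)).differentiableAt.differentiableWithinAt

/-- The Euler derivative of the logarithmic potential is `1` minus the Cauchy transform, because
`-x z / (1 - x z) = 1 - 1 / (1 - x z)`. -/
theorem euler_logPotential (ν : Measure UnitCircle) [IsProbabilityMeasure ν] {z : ℂ}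
    (hz : ‖z‖ < 1) : z * deriv (logPotential ν) z = 1 - cauchyTransform ν z := by
  have h1 : ∀ x : UnitCircle,
      z * (-(x : ℂ) / (1 - (x : ℂ) * z)) = 1 - (1 - (x : ℂ) * z)⁻¹ := fun x => by
    rw [eq_sub_iff_add_eq, mul_div_assoc', inv_eq_one_div, ← add_div,
      div_eq_one_iff_eq (x.one_sub_mul_ne_zero hz)]
    ring
  rw [(hasDerivAt_logPotential ν hz).deriv, ← integral_const_mul]
  simp only [h1]
  rw [integral_sub (integrable_const _) ((continuous_inv_one_sub_mul hz).integrable_unitCircle ν)]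
  simp [cauchyTransform]

/-! ### Poisson and Herglotz representations -/

theorem continuous_re_two_mul_inv_one_sub_mul_sub_one {z : ℂ} (hz : ‖z‖ < 1) :
    Continuous fun x : UnitCircle => (2 * (1 - (x : ℂ) * z)⁻¹ - 1).re :=
  Complex.continuous_re.comp
    ((continuous_const.mul (continuous_inv_one_sub_mul hz)).sub continuous_const)

/-- **Poisson representation**: a function that is harmonic on a neighbourhood of the closed unit
disk, nonnegative on the unit circle and equal to `1` at the origin is the Poisson integral of the
probability measure with density `u / (2 π)`. The measure is carried over by complex conjugation,
which turns the kernel `(ζ + w) / (ζ - w)` into `2 / (1 - x w) - 1`. -/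
theorem exists_probabilityMeasure_poisson {u : ℂ → ℝ}
    (hu : InnerProductSpace.HarmonicOnNhd u (Metric.closedBall 0 1)) (h0 : u 0 = 1)
    (hpos : ∀ ζ ∈ Metric.sphere (0 : ℂ) 1, 0 ≤ u ζ) :
    ∃ ν : ProbabilityMeasure UnitCircle, ∀ w ∈ Metric.ball (0 : ℂ) 1,
      ∫ x : UnitCircle, (2 * (1 - (x : ℂ) * w)⁻¹ - 1).re ∂(ν : Measure UnitCircle) = u w := by
  let ρ : ℝ → ℝ := fun θ => (2 * Real.pi)⁻¹ * u (circleMap 0 1 θ)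
  have hmem : ∀ θ : ℝ, circleMap 0 1 θ ∈ Metric.sphere (0 : ℂ) 1 := fun θ =>
    circleMap_mem_sphere 0 zero_le_one θ
  have hρ0 : ∀ θ, 0 ≤ ρ θ := fun θ =>
    mul_nonneg (by positivity) (hpos _ (hmem θ))
  have hρc : Continuous ρ := by
    refine continuous_const.mul (continuous_iff_continuousAt.2 fun θ => ?_)
    exact ((hu _ (Metric.sphere_subset_closedBall (hmem θ))).1.continuousAt).comp
      (continuous_circleMap 0 1).continuousAt
  let κ : ℝ → UnitCircle := fun θ =>
    ⟨starRingEnd ℂ (circleMap 0 1 θ), by simp⟩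
  have hκ : Continuous κ :=
    Continuous.subtype_mk (Complex.continuous_conj.comp (continuous_circleMap 0 1)) _
  let τ : Measure ℝ := volume.restrict (Set.Ioc 0 (2 * Real.pi))
  let σ : Measure ℝ := τ.withDensity fun θ => ENNReal.ofReal (ρ θ)
  have hPoisson : ∀ w ∈ Metric.ball (0 : ℂ) 1,
      ∫ θ, ρ θ * (2 * (1 - (κ θ : ℂ) * w)⁻¹ - 1).re ∂τ = u w := by
    intro w hw
    rw [← hu.circleAverage_re_herglotzRieszKernel_smul hw, Real.circleAverage_def,
      intervalIntegral.integral_of_le (by positivity), smul_eq_mul, ← integral_const_mul]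
    refine integral_congr_ae (Filter.Eventually.of_forall fun θ => ?_)
    have h1 : ‖circleMap 0 1 θ‖ = 1 := by simp
    have h2 : circleMap 0 1 θ * starRingEnd ℂ (circleMap 0 1 θ) = 1 := by
      rw [Complex.mul_conj', h1]; simp
    have h3 := (κ θ).one_sub_mul_ne_zero (z := w) (by simpa using hw)
    have h4 : circleMap 0 1 θ - w ≠ 0 := by
      intro h
      rw [← sub_eq_zero.1 h] at hw
      simp at hw
    have h5 : 2 * (1 - (κ θ : ℂ) * w)⁻¹ - 1 = herglotzRieszKernel 0 w (circleMap 0 1 θ) := by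
      have h6 : (1 - (κ θ : ℂ) * w)⁻¹ = circleMap 0 1 θ / (circleMap 0 1 θ - w) := by
        rw [inv_eq_one_div, div_eq_div_iff h3 h4]
        simp only [κ]
        linear_combination w * h2
      rw [herglotzRieszKernel_def, h6, eq_div_iff (by simpa using h4)]
      simp only [sub_zero]
      rw [sub_mul, mul_assoc, div_mul_cancel₀ _ h4]
      ring
    simp only [ρ, Pi.smul_apply', Function.comp_apply, smul_eq_mul, h5]
    ring
  -- The total mass is `u 0`, since the kernel is identically `1` at `w = 0`.
  have hσ : IsProbabilityMeasure σ := by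
    refine ⟨?_⟩
    have hint : Integrable ρ τ := (hρc.integrableOn_Icc).mono_set Set.Ioc_subset_Icc_self
    rw [withDensity_apply _ MeasurableSet.univ, Measure.restrict_univ,
      ← ofReal_integral_eq_lintegral_ofReal hint (Filter.Eventually.of_forall hρ0)]
    have h1 := hPoisson 0 (by simp)
    have h2 : ∀ θ, ρ θ * (2 * (1 - (κ θ : ℂ) * 0)⁻¹ - 1).re = ρ θ := fun θ => by norm_num
    simp only [h2, h0] at h1
    rw [h1, ENNReal.ofReal_one]
  refine ⟨⟨σ.map κ, Measure.isProbabilityMeasure_map hκ.measurable.aemeasurable⟩, fun w hw => ?_⟩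
  have hcont := continuous_re_two_mul_inv_one_sub_mul_sub_one (z := w) (by simpa using hw)
  rw [← hPoisson w hw, ProbabilityMeasure.coe_mk,
    integral_map hκ.measurable.aemeasurable hcont.aestronglyMeasurable,
    integral_withDensity_eq_integral_toReal_smul (by fun_prop)
      (Filter.Eventually.of_forall fun _ => ENNReal.ofReal_lt_top)]
  simp only [ENNReal.toReal_ofReal (hρ0 _), smul_eq_mul]

theorem re_two_mul_cauchyTransform_sub_one (ν : Measure UnitCircle) [IsProbabilityMeasure ν]
    {z : ℂ} (hz : ‖z‖ < 1) :
    (2 * cauchyTransform ν z - 1).re = ∫ x : UnitCircle, (2 * (1 - (x : ℂ) * z)⁻¹ - 1).re ∂ν := by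
  have hint := (continuous_inv_one_sub_mul hz).integrable_unitCircle ν
  have h1 : 2 * cauchyTransform ν z - 1 = ∫ x : UnitCircle, (2 * (1 - (x : ℂ) * z)⁻¹ - 1) ∂ν := by
    rw [integral_sub (hint.const_mul 2) (integrable_const 1), integral_const_mul]
    simp [cauchyTransform]
  rw [h1]
  exact (integral_re ((hint.const_mul 2).sub (integrable_const 1))).symm

/-- **Herglotz representation**: a holomorphic function on the unit disk with nonnegative real part
and value `1` at the origin is `∫ (1 + x z) / (1 - x z) dν(x)` for some probability measure `ν` on
the unit circle. The measure is a weak limit of those representing `z ↦ P (r z)` as `r → 1`. -/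
theorem exists_herglotz_representation {P : ℂ → ℂ}
    (hP : DifferentiableOn ℂ P (Metric.ball 0 1)) (h0 : P 0 = 1)
    (hre : ∀ z ∈ Metric.ball (0 : ℂ) 1, 0 ≤ (P z).re) :
    ∃ ν : ProbabilityMeasure UnitCircle, ∀ z ∈ Metric.ball (0 : ℂ) 1,
      P z = 2 * cauchyTransform ν z - 1 := by
  obtain ⟨r, -, hr, hrlim⟩ := exists_seq_strictMono_tendsto' (show (0 : ℝ) < 1 from one_pos)
  have hrz : ∀ n, ∀ z ∈ Metric.closedBall (0 : ℂ) 1, (r n : ℂ) * z ∈ Metric.ball (0 : ℂ) 1 := by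
    intro n z hz
    have hz1 : ‖z‖ ≤ 1 := by simpa using hz
    rw [mem_ball_zero_iff, norm_mul, Complex.norm_real, Real.norm_of_nonneg (hr n).1.le]
    calc r n * ‖z‖ ≤ r n * 1 := mul_le_mul_of_nonneg_left hz1 (hr n).1.le
      _ < 1 := by simpa using (hr n).2
  have hex : ∀ n, ∃ ν : ProbabilityMeasure UnitCircle, ∀ w ∈ Metric.ball (0 : ℂ) 1,
      ∫ x : UnitCircle, (2 * (1 - (x : ℂ) * w)⁻¹ - 1).re ∂(ν : Measure UnitCircle) =
        (P (r n * w)).re := by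
    intro n
    refine exists_probabilityMeasure_poisson (u := fun w => (P (r n * w)).re) (fun z hz => ?_)
      (by simp [h0]) fun ζ hζ => hre _ (hrz n ζ (Metric.sphere_subset_closedBall hζ))
    refine AnalyticAt.harmonicAt_re (f := fun w => P (r n * w)) ?_
    exact (hP.analyticAt (Metric.isOpen_ball.mem_nhds (hrz n z hz))).fun_comp
      (analyticAt_const.mul analyticAt_id)
  choose νs hνs using hex
  -- By weak compactness the measures converge along any ultrafilter finer than `atTop`.
  let 𝒰 : Ultrafilter ℕ := Ultrafilter.of Filter.atTop
  let ν : ProbabilityMeasure UnitCircle := (𝒰.map νs).lim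
  have hlim : Filter.Tendsto νs 𝒰 (nhds ν) := (𝒰.map νs).le_nhds_lim
  have hreEq : ∀ z ∈ Metric.ball (0 : ℂ) 1,
      (P z).re = (2 * cauchyTransform ν z - 1).re := by
    intro z hz
    have hz1 : ‖z‖ < 1 := by simpa using hz
    have hcont := continuous_re_two_mul_inv_one_sub_mul_sub_one hz1
    have hA : Filter.Tendsto (fun n => (P (r n * z)).re) 𝒰
        (nhds (∫ x : UnitCircle, (2 * (1 - (x : ℂ) * z)⁻¹ - 1).re ∂(ν : Measure UnitCircle))) := by
      have := ((ProbabilityMeasure.continuous_integral_continuousMap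
        (⟨_, hcont⟩ : C(UnitCircle, ℝ))).tendsto ν).comp hlim
      refine this.congr fun n => ?_
      exact hνs n z hz
    have hB : Filter.Tendsto (fun n => (P (r n * z)).re) 𝒰 (nhds (P z).re) := by
      have h1 : Filter.Tendsto (fun n => (r n : ℂ) * z) Filter.atTop (nhds z) := by
        simpa using ((Complex.continuous_ofReal.tendsto 1).comp hrlim).mul_const z
      have h2 := (hP.differentiableAt (Metric.isOpen_ball.mem_nhds hz)).continuousAt
      exact ((Complex.continuous_re.tendsto _).comp (h2.tendsto.comp h1)).mono_left
        (Ultrafilter.of_le _)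
    rw [re_two_mul_cauchyTransform_sub_one _ hz1]
    exact tendsto_nhds_unique hB hA
  refine ⟨ν, ?_⟩
  -- Equal real parts leave only an imaginary constant, which vanishes at the origin.
  have hC := (isDiskSeries_cauchyTransform (ν : Measure UnitCircle)).differentiableOn
  have hdiff : DifferentiableOn ℂ (fun z => P z - (2 * cauchyTransform ν z - 1))
      (Metric.ball 0 1) := hP.sub ((hC.const_mul 2).sub_const 1)
  obtain ⟨c, hc⟩ := (hdiff.analyticOnNhd Metric.isOpen_ball).eq_const_of_re_eq_const (c₀ := 0)
    (fun z hz => by rw [Complex.sub_re, hreEq z hz, sub_self]) Metric.isOpen_ball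
    ((convex_ball _ _).isConnected ⟨0, by simp⟩)
  have hc0 : c = 0 := by
    rw [← hc 0 (by simp), h0, cauchyTransform_zero]
    norm_num
  intro z hz
  rw [← sub_eq_zero, hc z hz, hc0]

/-! ### Exponential kernels -/

theorem expKernel_eq (p : ℕ) (α : ℝ) (ν : ProbabilityMeasure UnitCircle) (z : ℂ) :
    expKernel p α ν z = z ^ (-(p : ℤ)) *
      Complex.exp (2 * (p : ℂ) * (1 - (α : ℂ)) * logPotential ν z) := by
  rw [expKernel, integral_const_mul]
  rfl

theorem differentiableOn_exp_logPotential (c : ℂ) (ν : ProbabilityMeasure UnitCircle) :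
    DifferentiableOn ℂ (fun z => Complex.exp (c * logPotential ν z)) (Metric.ball 0 1) :=
  ((differentiableOn_logPotential ν).const_mul c).cexp

theorem exists_hasExpansion_of_differentiableOn (p : ℕ) {G : ℂ → ℂ}
    (hG : DifferentiableOn ℂ G (Metric.ball 0 1)) (h0 : G 0 = 1) :
    ∃ b, HasExpansion p (fun z => z ^ (-(p : ℤ)) * G z) b := by
  obtain ⟨c, hc⟩ := IsDiskSeries.exists_of_differentiableOn hG
  have hcons : consOne (fun n => c (n + 1)) = c := by
    funext n
    cases n with
    | zero => rw [hc.apply_zero, h0]; rfl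
    | succ n => rfl
  exact ⟨fun n => c (n + 1), hasExpansion_iff.2 ⟨G, hcons.symm ▸ hc, fun z _ => rfl⟩⟩

theorem exists_hasExpansion_expKernel (p : ℕ) (α : ℝ) (ν : ProbabilityMeasure UnitCircle) :
    ∃ b, HasExpansion p (expKernel p α ν) b := by
  have h := exists_hasExpansion_of_differentiableOn p
    (differentiableOn_exp_logPotential (2 * (p : ℂ) * (1 - (α : ℂ))) ν)
    (by simp [logPotential_zero])
  simpa only [← expKernel_eq] using h

theorem euler_exp_logPotential (c : ℂ) (ν : ProbabilityMeasure UnitCircle) {z : ℂ}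
    (hz : ‖z‖ < 1) :
    z * deriv (fun w => Complex.exp (c * logPotential ν w)) z =
      c * (1 - cauchyTransform ν z) * Complex.exp (c * logPotential ν z) := by
  have h := ((hasDerivAt_logPotential (ν : Measure UnitCircle) hz).differentiableAt.hasDerivAt
    |>.const_mul c).cexp
  rw [h.deriv, ← euler_logPotential _ hz]
  ring

/-! ### The inequality of the class -/

/-- For `h = z ^ (-p) * G` the inequality defining the class says that `G` has no zero and that
`Re (z G' / G) < p (1 - α)`: with `w = z G' / (p G)` it reads `|w| < |w - 2 (1 - α)|`. -/
theorem class_inequality_iff {p : ℕ} (hp : 1 ≤ p) {α : ℝ} (hα : α < 1) {h G : ℂ → ℂ}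
    (hG : DifferentiableOn ℂ G (Metric.ball 0 1))
    (hh : ∀ z ∈ puncturedDisk, h z = z ^ (-(p : ℤ)) * G z) {z : ℂ} (hz : z ∈ puncturedDisk) :
    (h z ≠ 0 ∧ ‖1 / (p : ℂ) * (z * deriv h z / h z) + 1‖ <
      1 * ‖1 / (p : ℂ) * (z * deriv h z / h z) + 2 * (α : ℂ) - 1‖) ↔
    (G z ≠ 0 ∧ (z * deriv G z / G z).re < p * (1 - α)) := by
  have hz0 := hz.1
  have hzp : z ^ (-(p : ℤ)) ≠ 0 := zpow_ne_zero _ hz0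
  have hp0 : (p : ℂ) ≠ 0 := by exact_mod_cast (by omega : p ≠ 0)
  have hpR : (0 : ℝ) < p := by exact_mod_cast hp
  have hne : h z ≠ 0 ↔ G z ≠ 0 := by
    rw [hh z hz, mul_ne_zero_iff, and_iff_right hzp]
  rw [hne]
  refine and_congr_right fun hGz => ?_
  have hGat := hG.differentiableAt (Metric.isOpen_ball.mem_nhds (puncturedDisk_subset_ball hz))
  have hd : z * deriv h z = z ^ (-(p : ℤ)) * (-p * G z + z * deriv G z) := by
    have heq : h =ᶠ[nhds z] fun w => w ^ (-(p : ℤ)) * G w :=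
      Filter.eventually_of_mem (isOpen_puncturedDisk.mem_nhds hz) hh
    rw [heq.deriv_eq, ((hasDerivAt_zpow (-(p : ℤ)) z (Or.inl hz0)).fun_mul
      hGat.hasDerivAt).deriv, zpow_sub_one₀ hz0]
    push_cast
    field_simp
  set w : ℂ := z * deriv G z / G z / p with hw
  have h1 : 1 / (p : ℂ) * (z * deriv h z / h z) = w - 1 := by
    rw [hd, hh z hz, mul_div_mul_left _ _ hzp, hw]
    field_simp
    ring
  have h2 : (z * deriv G z / G z).re = p * w.re := by
    rw [← Complex.re_ofReal_mul, hw]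
    congr 1
    push_cast
    field_simp
  rw [h1, h2, one_mul, mul_lt_mul_iff_right₀ hpR, ← sq_lt_sq₀ (norm_nonneg _) (norm_nonneg _),
    ← Complex.normSq_eq_norm_sq, ← Complex.normSq_eq_norm_sq, Complex.normSq_apply,
    Complex.normSq_apply]
  have e1 : (w - 1 + 1) = w := by ring
  have e2 : w - 1 + 2 * (α : ℂ) - 1 = w - ((2 * (1 - α) : ℝ) : ℂ) := by push_cast; ring
  rw [e1, e2]
  simp only [Complex.sub_re, Complex.sub_im, Complex.ofReal_re, Complex.ofReal_im, sub_zero]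
  constructor <;> intro h <;> nlinarith

/-- `exp (2 q S)`, with `S` a logarithmic potential, has Euler logarithmic derivative
`2 q (1 - C)`, whose real part is less than `q` because the Cauchy transform `C` has real part
greater than `1 / 2`. -/
theorem re_euler_exp_logPotential_lt {q : ℝ} (hq : 0 < q) (ν : ProbabilityMeasure UnitCircle)
    {z : ℂ} (hz : ‖z‖ < 1) :
    (z * deriv (fun w => Complex.exp (2 * (q : ℂ) * logPotential ν w)) z /
      Complex.exp (2 * (q : ℂ) * logPotential ν z)).re < q := by
  rw [euler_exp_logPotential _ _ hz, mul_div_cancel_right₀ _ (Complex.exp_ne_zero _)]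
  have h1 := half_lt_re_cauchyTransform (ν : Measure UnitCircle) hz
  have h2 : (2 * (q : ℂ) * (1 - cauchyTransform ν z)).re =
      2 * q * (1 - (cauchyTransform ν z).re) := by
    have : 2 * (q : ℂ) = ((2 * q : ℝ) : ℂ) := by push_cast; rfl
    rw [this, Complex.re_ofReal_mul, Complex.sub_re, Complex.one_re]
  rw [h2]
  nlinarith

/-- A zero-free holomorphic `G` on the disk with `G 0 = 1` and `Re (z G' / G) < q` is
`exp (2 q S)` for the logarithmic potential `S` of a probability measure: the Herglotz measure of
`1 - z G' / (q G)`. -/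
theorem exists_eq_exp_logPotential {q : ℝ} (hq : 0 < q) {G : ℂ → ℂ}
    (hG : DifferentiableOn ℂ G (Metric.ball 0 1)) (h0 : G 0 = 1)
    (hne : ∀ z ∈ Metric.ball (0 : ℂ) 1, G z ≠ 0)
    (hre : ∀ z ∈ Metric.ball (0 : ℂ) 1, (z * deriv G z / G z).re < q) :
    ∃ ν : ProbabilityMeasure UnitCircle, ∀ z ∈ Metric.ball (0 : ℂ) 1,
      G z = Complex.exp (2 * (q : ℂ) * logPotential ν z) := by
  have hqC : (q : ℂ) ≠ 0 := by exact_mod_cast hq.ne'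
  obtain ⟨ν, hν⟩ := exists_herglotz_representation
    (P := fun z => 1 - ((q⁻¹ : ℝ) : ℂ) * (z * deriv G z / G z))
    ((((differentiableOn_id.mul (hG.deriv Metric.isOpen_ball)).div hG hne).const_mul _).const_sub 1)
    (by simp) (fun z hz => by
      rw [Complex.sub_re, Complex.re_ofReal_mul, Complex.one_re, sub_nonneg,
        inv_mul_le_iff₀ hq, mul_one]
      exact (hre z hz).le)
  refine ⟨ν, ?_⟩
  have hlog : ∀ z ∈ Metric.ball (0 : ℂ) 1,
      z * deriv G z = 2 * (q : ℂ) * (1 - cauchyTransform ν z) * G z := by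
    intro z hz
    have h1 := hν z hz
    have h2 := hne z hz
    push_cast at h1
    field_simp at h1
    linear_combination (-1 : ℂ) * h1
  -- Hence `G * exp (-2 q S)` has vanishing Euler derivative and is constant.
  let E : ℂ → ℂ := fun z => Complex.exp (-(2 * (q : ℂ)) * logPotential ν z)
  have hE : DifferentiableOn ℂ E (Metric.ball 0 1) := differentiableOn_exp_logPotential _ ν
  have hconst := eqOn_const_of_euler_eq_zero (hG.mul hE) fun z hz => by
    have hz' := Metric.isOpen_ball.mem_nhds hz
    have h1 := euler_exp_logPotential (-(2 * (q : ℂ))) ν (z := z) (by simpa using hz)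
    change z * deriv E z = _ * E z at h1
    rw [deriv_mul (hG.differentiableAt hz') (hE.differentiableAt hz')]
    linear_combination E z * hlog z hz + G z * h1
  intro z hz
  have h1 := hconst z hz
  have hE0 : E 0 = 1 := by simp [E, logPotential_zero]
  simp only [Pi.mul_apply, h0, hE0, mul_one] at h1
  simp only [E, neg_mul, Complex.exp_neg] at h1
  exact (mul_inv_eq_one₀ (Complex.exp_ne_zero _)).1 h1

theorem eq_of_expKernel_eqOn {p : ℕ} (hp : 1 ≤ p) {α : ℝ} (hα : α < 1)
    {ν₁ ν₂ : ProbabilityMeasure UnitCircle}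
    (h : Set.EqOn (expKernel p α ν₁) (expKernel p α ν₂) puncturedDisk) : ν₁ = ν₂ := by
  have hp0 : (p : ℂ) ≠ 0 := by exact_mod_cast (by omega : p ≠ 0)
  have hα0 : (1 - (α : ℂ)) ≠ 0 := by exact_mod_cast (by linarith : (1 - α) ≠ 0)
  set c : ℂ := 2 * (p : ℂ) * (1 - (α : ℂ)) with hc
  have hc0 : c ≠ 0 := mul_ne_zero (mul_ne_zero two_ne_zero hp0) hα0
  have hexp : Set.EqOn (fun z => Complex.exp (c * logPotential ν₁ z))
      (fun z => Complex.exp (c * logPotential ν₂ z)) puncturedDisk := fun z hz => by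
    have := h hz
    rw [expKernel_eq, expKernel_eq] at this
    exact mul_left_cancel₀ (zpow_ne_zero _ hz.1) this
  suffices hC : Set.EqOn (cauchyTransform ν₁) (cauchyTransform ν₂) puncturedDisk from
    Subtype.ext (eq_of_cauchyTransform_eqOn (ν₁ := (ν₁ : Measure UnitCircle))
      (ν₂ := (ν₂ : Measure UnitCircle)) hC)
  intro z hz
  have hd := (hexp.eventuallyEq_of_mem (isOpen_puncturedDisk.mem_nhds hz)).deriv_eq
  have h1 := euler_exp_logPotential c ν₁ hz.2
  have h2 := euler_exp_logPotential c ν₂ hz.2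
  have h3 : Complex.exp (c * logPotential ν₁ z) = Complex.exp (c * logPotential ν₂ z) := hexp hz
  rw [hd, h2, h3] at h1
  exact (sub_right_inj.1
    (mul_left_cancel₀ hc0 (mul_right_cancel₀ (Complex.exp_ne_zero _) h1))).symm

/-- The inequality defining the class holds precisely when the iterate is one of the exponential
kernels. -/
theorem classInequality_iff {lam mu α : ℝ} {m p : ℕ} (hα : α < 1) (hp : 1 ≤ p) {f : ℂ → ℂ}
    (hf : IsMeroForm p f) :
    ClassInequality lam mu m p α 1 f ↔ ∃ ν : ProbabilityMeasure UnitCircle,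
      Set.EqOn (diffOpIter lam mu m p f) (expKernel p α ν) puncturedDisk := by
  obtain ⟨-, a, ha⟩ := hf
  have hq : 0 < (p : ℝ) * (1 - α) :=
    mul_pos (by exact_mod_cast hp) (by linarith)
  have hcast : 2 * (p : ℂ) * (1 - (α : ℂ)) = 2 * (((p : ℝ) * (1 - α) : ℝ) : ℂ) := by
    push_cast; ring
  obtain ⟨G, hGs, hfG⟩ := hasExpansion_iff.1 (ha.diffOpIter (lam := lam) (mu := mu) (m := m))
  have hG := hGs.differentiableOn
  have h0 : G 0 = 1 := hGs.apply_zero.symm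
  have hclass : ClassInequality lam mu m p α 1 f ↔ ∀ z ∈ puncturedDisk,
      G z ≠ 0 ∧ (z * deriv G z / G z).re < p * (1 - α) :=
    forall₂_congr fun _ hz => class_inequality_iff hp hα hG hfG hz
  rw [hclass]
  constructor
  · intro h
    -- The class inequality leaves out the origin, where `z G' / G` vanishes.
    have hball : ∀ z ∈ Metric.ball (0 : ℂ) 1,
        G z ≠ 0 ∧ (z * deriv G z / G z).re < p * (1 - α) := by
      intro z hz
      by_cases hz0 : z = 0
      · subst hz0
        simpa [h0] using hq
      · exact h z ⟨hz0, by simpa using hz⟩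
    obtain ⟨ν, hν⟩ := exists_eq_exp_logPotential hq hG h0 (fun z hz => (hball z hz).1)
      fun z hz => (hball z hz).2
    refine ⟨ν, fun z hz => ?_⟩
    rw [hfG z hz, expKernel_eq, hcast, hν z (puncturedDisk_subset_ball hz)]
  · rintro ⟨ν, hν⟩ z hz
    have heq : Set.EqOn G
        (fun z => Complex.exp (2 * (((p : ℝ) * (1 - α) : ℝ) : ℂ) * logPotential ν z))
        puncturedDisk := fun w hw => by
      have := hν hw
      rw [hfG w hw, expKernel_eq, hcast] at this
      exact mul_left_cancel₀ (zpow_ne_zero _ hw.1) this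
    rw [(heq.eventuallyEq_of_mem (isOpen_puncturedDisk.mem_nhds hz)).deriv_eq, heq hz]
    exact ⟨Complex.exp_ne_zero _, re_euler_exp_logPotential_lt hq ν hz.2⟩

/-! ### The representation theorem -/

/-- First clause: the characterization. Remaining clauses: the correspondence between functions and
measures is one-to-one. Each function of the class has exactly one representing measure (this needs
only the form of `f` and the inequality, not `p`-valence), a measure represents at most one function
on the punctured disk, and every probability measure represents an analytic function of the right
form that satisfies the inequality defining the class. -/
theorem theorem2p2 (lam mu α : ℝ) (m p : ℕ) (hmu : 0 ≤ mu) (hlam : mu ≤ lam)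
    (hα0 : 0 ≤ α) (hα1 : α < 1) (hp : 1 ≤ p) :
    (∀ f : ℂ → ℂ, IsSigma p f →
      (IsSigmaClass lam mu m p α 1 f ↔
        ∃ ν : ProbabilityMeasure (Metric.sphere (0 : ℂ) 1),
          IsRepresentedBy lam mu m p α f ν)) ∧
    (∀ f : ℂ → ℂ, IsMeroForm p f → ClassInequality lam mu m p α 1 f →
      ∃! ν : ProbabilityMeasure (Metric.sphere (0 : ℂ) 1),
        IsRepresentedBy lam mu m p α f ν) ∧
    (∀ (ν : ProbabilityMeasure (Metric.sphere (0 : ℂ) 1)) (f g : ℂ → ℂ),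
      IsRepresentedBy lam mu m p α f ν → IsRepresentedBy lam mu m p α g ν →
        Set.EqOn f g puncturedDisk) ∧
    (∀ ν : ProbabilityMeasure (Metric.sphere (0 : ℂ) 1), ∃ f : ℂ → ℂ,
      IsMeroForm p f ∧ ClassInequality lam mu m p α 1 f ∧
        IsRepresentedBy lam mu m p α f ν) := by
  have hrep : ∀ f : ℂ → ℂ, IsMeroForm p f → ∀ ν : ProbabilityMeasure UnitCircle,
      IsRepresentedBy lam mu m p α f ν ↔
        Set.EqOn (diffOpIter lam mu m p f) (expKernel p α ν) puncturedDisk := fun f hf ν => by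
    rw [isRepresentedBy_iff hmu hlam, and_iff_right hf.2]
  have hclass : ∀ f : ℂ → ℂ, IsMeroForm p f → (ClassInequality lam mu m p α 1 f ↔
      ∃ ν : ProbabilityMeasure UnitCircle, IsRepresentedBy lam mu m p α f ν) := fun f hf => by
    simp only [classInequality_iff hα1 hp hf, hrep f hf]
  refine ⟨fun f hf => ?_, fun f hf h => ?_, ?_, fun ν => ?_⟩
  · rw [IsSigmaClass, and_iff_right hf]
    exact hclass f hf.1
  · obtain ⟨ν, hν⟩ := (hclass f hf).1 h
    refine ⟨ν, hν, fun ν' hν' => eq_of_expKernel_eqOn hp hα1 ?_⟩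
    exact ((hrep f hf ν').1 hν').symm.trans ((hrep f hf ν).1 hν)
  · rintro ν f g ⟨a, b, ha, hb, hf⟩ ⟨a', b', ha', hb', hg⟩
    obtain rfl := ha.unique ha'
    obtain rfl := hb.unique hb'
    exact hf.eqOn hg
  · obtain ⟨b, hb⟩ := exists_hasExpansion_expKernel p α ν
    obtain ⟨f, hf, heq⟩ := exists_diffOpIter_eqOn hmu hlam (m := m) hb
    have hν := (hrep f hf ν).2 heq
    exact ⟨f, hf, (hclass f hf).2 ⟨ν, hν⟩, hν⟩
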